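/- Let $\mathrm{Int}(\mathbb{Z}) = \{g \in \mathbb{Q}[x] : g(\mathbb{Z}) \subseteq \mathbb{Z}\}$ be the ring of integer-valued polynomials. For $f \in \mathrm{Int}(\mathbb{Z})$, the set of lengths of $f$ is the set of all integers $n \ge 1$ such that $f = s_1 \cdots s_n$ for some irreducible elements $s_1, \dots, s_n$ (not necessarily distinct) of the ring $\mathrm{Int}(\mathbb{Z})$; here an element is irreducible if it is a non-zero non-unit that is not a product of two non-units. Corollary. For every finite set $S$ of integers greater than $1$ there exists a polynomial $f \in \mathrm{Int}(\mathbb{Z})$ whose set of lengths is exactly $S$. -/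

import Mathlib

open Polynomial

/-- The ring `Int(ℤ)` of integer-valued polynomials: all `f ∈ ℚ[x]` with `f(ℤ) ⊆ ℤ`. -/
def integerValued : Subring ℚ[X] where
  carrier := {f | ∀ a : ℤ, ∃ b : ℤ, f.eval (a : ℚ) = (b : ℚ)}
  mul_mem' {f g} hf hg a := by
    obtain ⟨b, hb⟩ := hf a
    obtain ⟨c, hc⟩ := hg a
    exact ⟨b * c, by simp [hb, hc]⟩
  one_mem' a := ⟨1, by simp⟩
  add_mem' {f g} hf hg a := by
    obtain ⟨b, hb⟩ := hf a
    obtain ⟨c, hc⟩ := hg a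
    exact ⟨b + c, by simp [hb, hc]⟩
  zero_mem' a := ⟨0, by simp⟩
  neg_mem' {f} hf a := by
    obtain ⟨b, hb⟩ := hf a
    exact ⟨-b, by simp [hb]⟩

/-- The set of lengths of `r` in a commutative ring `R`: all positive integers `n` such that
`r` is a product `s₁ ⋯ sₙ` of `n` (not necessarily distinct) irreducible elements of `R`. -/
def setOfLengths {R : Type*} [CommRing R] (r : R) : Set ℕ :=
  {n | 0 < n ∧ ∃ s : Fin n → R, (∀ i, Irreducible (s i)) ∧ r = ∏ i, s i}

/-!
The element `f` is a product `∏ i, g i` of polynomials irreducible in `ℚ[X]`, all with value `1`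
at `1`. If a subproduct is written as a product of two elements of `Int(ℤ)`, unique factorization
in `ℚ[X]` makes the factors constant multiples of complementary subproducts, and evaluation at `1`
shows that the constants are integers with product `± 1` (`IsSignedProd.exists_of_mul`). Hence the
factorizations of `f` in `Int(ℤ)` are determined by the family of index sets `T` for which
`∏ i ∈ T, g i` is integer-valued: irreducible elements correspond to the nonempty members that do
not split into two nonempty members (`IsAtomicSet`).

This family can be prescribed by a hypergraph on a vertex set `V`
(`exists_irreducible_prod_mem_integerValued_iff`). The indices are `Option V`; the `g (some v)` have
integer coefficients, `g none` is an integer polynomial divided by an odd prime `p`, and a product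
containing `g none` is integer-valued iff its numerator vanishes modulo `p` at every residue class.
Letting `g (some v)` vanish exactly on the classes assigned to the hyperedges through `v`, this says
that the vertices present form a vertex cover. Polynomials that are irreducible and have prescribed
values modulo `p` and at `1` are Eisenstein at `2` (`exists_irreducible_eval_eq`).

For such a family, a factorization of `f` consists of one irreducible element belonging to `none`
and a minimal vertex cover, together with the `g (some v)` for all remaining `v`. The minimal vertex
covers of a complete multipartite graph are the complements of its parts
(`isAtomicSet_iff_exists_eq_complPart`), so the lengths are one more than the sizes of the parts,
and parts of size `n - 1`, `n ∈ S`, give the set of lengths `S`.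
-/

/-! ### Polynomials with prescribed values modulo a prime -/

/-- Every function on `ZMod p` is induced by an integer polynomial of degree less than `p`. -/
theorem exists_int_polynomial_eval_eq (p : ℕ) [Fact p.Prime] (t : ZMod p → ZMod p) :
    ∃ g : ℤ[X], g.natDegree < p ∧ ∀ a : ℤ, ((g.eval a : ℤ) : ZMod p) = t a := by
  have hinj : Set.InjOn (id : ZMod p → ZMod p) (Finset.univ : Finset (ZMod p)) :=
    Function.injective_id.injOn
  obtain ⟨g, hg, hdeg⟩ := exists_degree_eq_of_mem_lifts
    (mem_lifts_of_surjective (ZMod.intCast_surjective (n := p))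
      (f := Int.castRingHom (ZMod p)) (Lagrange.interpolate Finset.univ id t))
  refine ⟨g, ?_, fun a => ?_⟩
  · have h := Lagrange.degree_interpolate_lt t hinj
    rw [← hdeg, Finset.card_univ, ZMod.card] at h
    rcases eq_or_ne g 0 with rfl | hg0
    · simpa using (Fact.out : p.Prime).pos
    · exact (natDegree_lt_iff_degree_lt hg0).2 h
  · have h := Lagrange.eval_interpolate_at_node t hinj (Finset.mem_univ (a : ZMod p))
    rw [← hg, id, eval_intCast_map] at h
    simpa using h

/-- The polynomial constructed is `X ^ (p + 1) + 2 (k + (X - 1) g)` with `c = 2 k + 1`: thanks to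
the factor `X - 1` the value at `1` does not depend on `g`, which is chosen modulo `p` to produce
the values `t`, and modulo `2` to make the polynomial Eisenstein at `2`. -/
theorem exists_irreducible_eval_eq (p : ℕ) [Fact p.Prime] (hp : Odd p) (t : ZMod p → ZMod p)
    (c : ℤ) (hc : Odd c) (hct : (c : ZMod p) = t 1) :
    ∃ f : ℤ[X], Irreducible (f.map (Int.castRingHom ℚ)) ∧ f.eval 1 = c ∧
      ∀ a : ℤ, ((f.eval a : ℤ) : ZMod p) = t a := by
  obtain ⟨k, rfl⟩ := hc
  obtain ⟨g₀, hdeg, hval⟩ := exists_int_polynomial_eval_eq p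
    (fun x => (t x - x ^ (p + 1) - 2 * k) / (2 * (x - 1)))
  -- The correction term is divisible by `p`, and makes `k - g.eval 0` odd.
  set g : ℤ[X] := g₀ + C ((k - g₀.eval 0 + 1) * p) with hg
  have hgdeg : g.natDegree < p := (natDegree_add_C).trans_lt hdeg
  have hk : Odd (k - g.eval 0) := by
    obtain ⟨j, hj⟩ := hp
    have : k - g.eval 0 = (k - g₀.eval 0) - (k - g₀.eval 0 + 1) * (2 * j + 1) := by
      simp [hg, hj]; ring
    rw [this]
    exact ⟨-(k - g₀.eval 0 + 1) * j - 1, by ring⟩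
  set r : ℤ[X] := C k + (X - 1) * g with hr
  have hrdeg : (C 2 * r).natDegree < p + 1 := by
    refine (natDegree_C_mul_le _ _).trans_lt ((natDegree_C_add).trans_lt ?_)
    refine natDegree_mul_le.trans_lt ?_
    have : (X - 1 : ℤ[X]).natDegree ≤ 1 := natDegree_X_sub_C_le (1 : ℤ)
    lia
  have hmonic : (X ^ (p + 1) + C 2 * r).Monic :=
    monic_X_pow_add ((degree_le_natDegree).trans_lt (by exact_mod_cast hrdeg))
  have hnat : (X ^ (p + 1) + C 2 * r).natDegree = p + 1 := by
    rw [natDegree_add_eq_left_of_natDegree_lt (by rwa [natDegree_X_pow]), natDegree_X_pow]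
  refine ⟨X ^ (p + 1) + C 2 * r, ?_, ?_, fun a => ?_⟩
  · refine (hmonic.irreducible_iff_irreducible_map_fraction_map (K := ℚ)).1 ?_
    have hprime : (Ideal.span {(2 : ℤ)}).IsPrime :=
      (Ideal.span_singleton_prime two_ne_zero).2 Int.prime_two
    refine IsEisensteinAt.irreducible (𝓟 := Ideal.span {(2 : ℤ)}) ⟨?_, fun {n} hn => ?_, ?_⟩
      hprime hmonic.isPrimitive (by omega)
    · rw [hmonic.leadingCoeff]
      exact (Ideal.ne_top_iff_one _).1 hprime.ne_top
    · rw [hnat] at hn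
      rw [coeff_add, coeff_X_pow, if_neg hn.ne, zero_add, coeff_C_mul]
      exact Ideal.mem_span_singleton.2 (dvd_mul_right _ _)
    · rw [Ideal.span_singleton_pow, Ideal.mem_span_singleton, coeff_zero_eq_eval_zero]
      obtain ⟨j, hj⟩ := hk
      simp [hr]
      omega
  · simp [hr]; ring
  · by_cases ha : (a : ZMod p) = 1
    · have h1 : ((eval a (X ^ (p + 1) + C 2 * r) : ℤ) : ZMod p) = 1 + 2 * k := by
        simp [hr, ha]
      rw [h1, ha, ← hct]; push_cast; ring
    · have h2 : (2 : ZMod p) ≠ 0 := Ring.two_ne_zero (by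
        rw [ZMod.ringChar_zmod_n]
        rintro rfl
        exact absurd hp (by decide))
      have h3 : (a : ZMod p) - 1 ≠ 0 := sub_ne_zero.2 ha
      have h4 : ((g.eval a : ℤ) : ZMod p) = (t a - a ^ (p + 1) - 2 * k) / (2 * (a - 1)) := by
        rw [← hval]; simp [hg]
      have h5 : ((eval a (X ^ (p + 1) + C 2 * r) : ℤ) : ZMod p)
          = a ^ (p + 1) + 2 * (k + (a - 1) * ((g.eval a : ℤ) : ZMod p)) := by
        simp [hr]
      rw [h5, h4]
      field_simp
      ring

/-! ### Realizing hypergraph covers by integer-valued products -/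

/-- An integer polynomial divided by a prime `p` is integer-valued iff all its values are
divisible by `p`. -/
theorem C_inv_mul_map_mem_integerValued {p : ℕ} (hp : p ≠ 0) (f : ℤ[X]) :
    C (p : ℚ)⁻¹ * f.map (Int.castRingHom ℚ) ∈ integerValued ↔ ∀ a : ℤ, (p : ℤ) ∣ f.eval a := by
  have hp' : (p : ℚ) ≠ 0 := by exact_mod_cast hp
  refine forall_congr' fun a => exists_congr fun b => ?_
  rw [eval_mul, eval_C, eval_intCast_map, inv_mul_eq_iff_eq_mul₀ hp', Int.cast_id]
  simp only [eq_intCast]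
  exact_mod_cast Iff.rfl

theorem map_mem_integerValued (f : ℤ[X]) : f.map (Int.castRingHom ℚ) ∈ integerValued :=
  fun a => ⟨f.eval a, by rw [eval_intCast_map]; simp⟩

/-- Given a finite family `E` of subsets of `V`, there are irreducible polynomials `g none` and
`g (some v)`, `v : V`, normalized to have value `1` at `1`, such that a product of distinct ones
among them is integer-valued iff it omits `g none` or the `g (some v)` occurring in it form a
vertex cover of the hypergraph `E`. Each hyperedge is assigned a residue class modulo a prime `p`;
`g (some v)` vanishes modulo `p` on the classes of the hyperedges through `v`, and `p * g none` on
all classes that belong to no hyperedge. -/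
theorem exists_irreducible_prod_mem_integerValued_iff {V ι : Type*} [DecidableEq V] [Fintype ι]
    (E : ι → Finset V) :
    ∃ g : Option V → ℚ[X], (∀ i, Irreducible (g i)) ∧ (∀ i, (g i).eval 1 = 1) ∧
      ∀ T : Finset (Option V), ∏ i ∈ T, g i ∈ integerValued ↔
        (none ∈ T → ∀ e, ∃ v ∈ E e, some v ∈ T) := by
  classical
  obtain ⟨p, hle, hp⟩ := Nat.exists_infinite_primes (Fintype.card ι + 3)
  have : Fact p.Prime := ⟨hp⟩
  have hodd : Odd p := hp.odd_of_ne_two (by omega)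
  have hp0 : (p : ℚ) ≠ 0 := by exact_mod_cast hp.ne_zero
  obtain ⟨r⟩ : Nonempty (ι ↪ {x : ZMod p // x ≠ 1}) := by
    refine Function.Embedding.nonempty_of_card_le ?_
    rw [Fintype.card_subtype_compl, ZMod.card, Fintype.card_subtype_eq]
    omega
  have hr : ∀ e, (r e : ZMod p) ≠ 1 := fun e => (r e).2
  have hinj : ∀ {e e'}, (r e : ZMod p) = r e' → e = e' := fun h => r.injective (Subtype.ext h)
  have key₁ : ∀ v, ∃ f : ℤ[X], Irreducible (f.map (Int.castRingHom ℚ)) ∧ f.eval 1 = 1 ∧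
      ∀ a : ℤ, ((f.eval a : ℤ) : ZMod p) = if ∃ e, v ∈ E e ∧ (r e : ZMod p) = a then 0 else 1 :=
    fun v => exists_irreducible_eval_eq p hodd
      (fun x => if ∃ e, v ∈ E e ∧ (r e : ZMod p) = x then 0 else 1) 1 odd_one
      (by rw [if_neg (by rintro ⟨e, -, he⟩; exact hr e he), Int.cast_one])
  obtain ⟨f₀, hf₀, hone₀, hval₀⟩ := exists_irreducible_eval_eq p hodd
    (fun x => if ∃ e, (r e : ZMod p) = x then 1 else 0) p (by exact_mod_cast hodd)
      (by rw [if_neg (by rintro ⟨e, he⟩; exact hr e he)]; simp)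
  choose f hf hone hval using key₁
  let F : Option V → ℤ[X] := fun i => i.elim f₀ f
  let g : Option V → ℚ[X] := fun i =>
    i.elim (C (p : ℚ)⁻¹ * f₀.map (Int.castRingHom ℚ)) fun v => (f v).map (Int.castRingHom ℚ)
  have hg : ∀ T : Finset (Option V), none ∉ T →
      ∏ i ∈ T, g i = (∏ i ∈ T, F i).map (Int.castRingHom ℚ) := fun T hT => by
    rw [Polynomial.map_prod]
    refine Finset.prod_congr rfl fun i hi => ?_
    cases i with
    | none => exact absurd hi hT
    | some v => rfl
  refine ⟨g, ?_, ?_, fun T => ?_⟩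
  · rintro (_ | v)
    · exact (irreducible_isUnit_mul (isUnit_C.2 (inv_ne_zero hp0).isUnit)).2 hf₀
    · exact hf v
  · have h1 : ∀ q : ℤ[X], (q.map (Int.castRingHom ℚ)).eval 1 = (q.eval 1 : ℤ) := fun q => by simp
    rintro (_ | v)
    · simp [g, h1, hone₀, hp0]
    · simp [g, h1, hone]
  · by_cases hT : none ∈ T
    · have hprod : ∏ i ∈ T, g i =
          C (p : ℚ)⁻¹ * (∏ i ∈ T, F i).map (Int.castRingHom ℚ) := by
        rw [← Finset.mul_prod_erase T g hT, ← Finset.mul_prod_erase T F hT,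
          hg _ (Finset.notMem_erase _ _), Polynomial.map_mul, ← mul_assoc]
        rfl
      rw [hprod, C_inv_mul_map_mem_integerValued hp.ne_zero]
      have hdvd : ∀ a : ℤ, (p : ℤ) ∣ (∏ i ∈ T, F i).eval a ↔
          ∃ i ∈ T, (((F i).eval a : ℤ) : ZMod p) = 0 := fun a => by
        rw [← ZMod.intCast_zmod_eq_zero_iff_dvd, eval_prod, Int.cast_prod, Finset.prod_eq_zero_iff]
      simp only [hdvd, hT, true_imp_iff]
      constructor
      · intro h e
        obtain ⟨a, ha⟩ := ZMod.intCast_surjective (r e : ZMod p)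
        obtain ⟨i, hi, hi0⟩ := h a
        cases i with
        | none =>
          have := hval₀ a
          rw [if_pos ⟨e, ha.symm⟩] at this
          exact absurd (this.symm.trans hi0) one_ne_zero
        | some v =>
          have h2 : (if ∃ e, v ∈ E e ∧ (r e : ZMod p) = a then (0 : ZMod p) else 1) = 0 :=
            (hval v a).symm.trans hi0
          obtain ⟨e', hv, he'⟩ : ∃ e, v ∈ E e ∧ (r e : ZMod p) = a := by
            by_contra hne
            rw [if_neg hne] at h2
            exact one_ne_zero h2
          obtain rfl := hinj (he'.trans ha)
          exact ⟨v, hv, hi⟩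
      · intro h a
        by_cases ha : ∃ e, (r e : ZMod p) = a
        · obtain ⟨e, he⟩ := ha
          obtain ⟨v, hv, hvT⟩ := h e
          exact ⟨some v, hvT, (hval v a).trans (if_pos ⟨e, hv, he⟩)⟩
        · exact ⟨none, hT, (hval₀ a).trans (if_neg ha)⟩
    · simp only [hT, false_imp_iff, iff_true, hg T hT]
      exact map_mem_integerValued _

/-! ### Factorizations of normalized products in `Int(ℤ)` -/

/-- `s` is, up to sign, the product of the `g i` with `i ∈ T`. -/
def IsSignedProd {I : Type*} (g : I → ℚ[X]) (T : Finset I) (s : integerValued) : Prop :=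
  ∃ ε : ℤˣ, (s : ℚ[X]) = C ((ε : ℤ) : ℚ) * ∏ i ∈ T, g i

/-- The index sets of the irreducible products: those nonempty `T` with `∏ i ∈ T, g i`
integer-valued that are not disjoint unions of two nonempty index sets with this property. -/
structure IsAtomicSet {I : Type*} [DecidableEq I] (g : I → ℚ[X]) (T : Finset I) : Prop where
  nonempty : T.Nonempty
  mem : ∏ i ∈ T, g i ∈ integerValued
  eq_empty_or_eq : ∀ t ⊆ T, ∏ i ∈ t, g i ∈ integerValued → ∏ i ∈ T \ t, g i ∈ integerValued →
    t = ∅ ∨ t = T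

theorem C_intUnit_mul_mem_integerValued {ε : ℤˣ} {f : ℚ[X]} :
    C ((ε : ℤ) : ℚ) * f ∈ integerValued ↔ f ∈ integerValued := by
  rcases Int.units_eq_one_or ε with rfl | rfl <;> simp

section Factorization

variable {I : Type*} {g : I → ℚ[X]} {T : Finset I} {s r : integerValued}

theorem IsSignedProd.prod_mem (hs : IsSignedProd g T s) : ∏ i ∈ T, g i ∈ integerValued := by
  obtain ⟨ε, hε⟩ := hs
  exact C_intUnit_mul_mem_integerValued.1 (hε ▸ s.2)

theorem isSignedProd_mk (h : ∏ i ∈ T, g i ∈ integerValued) : IsSignedProd g T ⟨_, h⟩ :=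
  ⟨1, by simp⟩

theorem IsSignedProd.isUnit_iff (hirr : ∀ i, Irreducible (g i)) (hs : IsSignedProd g T s) :
    IsUnit s ↔ T = ∅ := by
  obtain ⟨ε, hε⟩ := hs
  constructor
  · intro hu
    have hu' : IsUnit (s : ℚ[X]) := hu.map integerValued.subtype
    rw [hε] at hu'
    by_contra hT
    obtain ⟨i, hi⟩ := Finset.nonempty_iff_ne_empty.2 hT
    exact (hirr i).not_isUnit
      (isUnit_of_dvd_unit ((Finset.dvd_prod_of_mem g hi).trans (dvd_mul_left _ _)) hu')
  · rintro rfl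
    refine IsUnit.of_mul_eq_one s (Subtype.ext ?_)
    rcases Int.units_eq_one_or ε with rfl | rfl <;> simp [hε]

variable [DecidableEq I]

/-- Integrality at `1`, where each `g i` has value `1`, forces the constants in a factorization
of a product of the `g i` to be `± 1`. -/
theorem IsSignedProd.exists_of_mul (hirr : ∀ i, Irreducible (g i)) (hone : ∀ i, (g i).eval 1 = 1)
    (h : IsSignedProd g T (s * r)) :
    ∃ t ⊆ T, IsSignedProd g t s ∧ IsSignedProd g (T \ t) r := by
  obtain ⟨ε, hε⟩ := h
  obtain ⟨t, u, b, c, rfl, hdisj, hbc, hs, hr⟩ :=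
    mul_eq_mul_prime_prod (p := g) (fun i _ => (hirr i).prime) hε
  have hunit : IsUnit (b * c) := by
    rw [← hbc, isUnit_C, isUnit_iff_ne_zero]
    exact_mod_cast ε.ne_zero
  obtain ⟨b, -, rfl⟩ := Polynomial.isUnit_iff.1 (isUnit_of_mul_isUnit_left hunit)
  obtain ⟨c, -, rfl⟩ := Polynomial.isUnit_iff.1 (isUnit_of_mul_isUnit_right hunit)
  obtain ⟨m, hm⟩ := s.2 1
  obtain ⟨n, hn⟩ := r.2 1
  have hm' : b = m := by simpa [hs, eval_prod, hone] using hm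
  have hn' : c = n := by simpa [hr, eval_prod, hone] using hn
  have hmn : (ε : ℤ) = m * n := by
    have := congrArg (eval 1) hbc
    simp only [eval_C, eval_mul, hm', hn'] at this
    exact_mod_cast this
  have hmu : IsUnit (m * n) := hmn ▸ ε.isUnit
  refine ⟨t, Finset.subset_union_left, ⟨(isUnit_of_mul_isUnit_left hmu).unit, ?_⟩,
    ⟨(isUnit_of_mul_isUnit_right hmu).unit, ?_⟩⟩
  · rw [hs, hm', IsUnit.unit_spec]
  · rw [hr, hn', IsUnit.unit_spec, Finset.union_sdiff_cancel_left hdisj]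

theorem IsSignedProd.irreducible_iff (hirr : ∀ i, Irreducible (g i))
    (hone : ∀ i, (g i).eval 1 = 1) (hs : IsSignedProd g T s) :
    Irreducible s ↔ IsAtomicSet g T := by
  constructor
  · intro h
    refine ⟨Finset.nonempty_iff_ne_empty.2 fun hT => h.not_isUnit ((hs.isUnit_iff hirr).2 hT),
      hs.prod_mem, fun t ht hmem hmem' => ?_⟩
    obtain ⟨ε, hε⟩ := hs
    have hprod : s = ⟨_, C_intUnit_mul_mem_integerValued (ε := ε).2 hmem⟩ * ⟨_, hmem'⟩ := by
      refine Subtype.ext ?_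
      rw [hε, ← Finset.prod_sdiff ht]
      simp only [Subring.coe_mul]
      ring
    refine (h.isUnit_or_isUnit hprod).imp (fun hu => ?_) fun hu => ?_
    · exact (IsSignedProd.isUnit_iff hirr ⟨ε, rfl⟩).1 hu
    · exact ht.antisymm (Finset.sdiff_eq_empty_iff_subset.1
        (((isSignedProd_mk hmem').isUnit_iff hirr).1 hu))
  · intro hT
    refine ⟨fun hu => hT.nonempty.ne_empty ((hs.isUnit_iff hirr).1 hu), fun a b hab => ?_⟩
    subst hab
    obtain ⟨t, ht, ha, hb⟩ := hs.exists_of_mul hirr hone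
    refine (hT.eq_empty_or_eq t ht ha.prod_mem hb.prod_mem).imp (fun h => ?_) fun h => ?_
    · exact (ha.isUnit_iff hirr).2 h
    · exact (hb.isUnit_iff hirr).2 (by rw [h, Finset.sdiff_self])

end Factorization

theorem mem_setOfLengths_iff_multiset {R : Type*} [CommRing R] {x : R} {n : ℕ} :
    n ∈ setOfLengths x ↔
      0 < n ∧ ∃ m : Multiset R, (∀ s ∈ m, Irreducible s) ∧ m.card = n ∧ m.prod = x := by
  refine and_congr_right fun _ => ⟨?_, ?_⟩
  · rintro ⟨s, hs, rfl⟩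
    exact ⟨Finset.univ.val.map s, by simpa using hs, by simp, rfl⟩
  · rintro ⟨m, hm, rfl, rfl⟩
    induction m using Quotient.inductionOn with
    | h l =>
      refine ⟨l.get, fun i => hm _ (Multiset.mem_coe.2 (l.get_mem i)), ?_⟩
      change l.prod = ∏ i : Fin l.length, l.get i
      rw [← List.prod_ofFn, List.ofFn_get]

/-! ### Complete multipartite graphs -/

section Multipartite

variable {V κ : Type*} [DecidableEq V] {g : Option V → ℚ[X]}

/-- A product of `g (some v)`s is integer-valued, and so are all its parts, hence its only
factorization is the obvious one. -/
theorem card_eq_of_isSignedProd (hirr : ∀ i, Irreducible (g i)) (hone : ∀ i, (g i).eval 1 = 1)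
    (hmem : ∀ T, none ∉ T → ∏ i ∈ T, g i ∈ integerValued)
    (m : Multiset integerValued) (hm : ∀ s ∈ m, Irreducible s) (T : Finset (Option V))
    (hT : none ∉ T) (h : IsSignedProd g T m.prod) : m.card = T.card := by
  induction m using Multiset.induction generalizing T with
  | empty =>
    rw [(h.isUnit_iff hirr).1 (by simp)]
    simp
  | cons s m ih =>
    rw [Multiset.prod_cons] at h
    obtain ⟨t, ht, hs, hr⟩ := h.exists_of_mul hirr hone
    have hat := (hs.irreducible_iff hirr hone).1 (hm s (by simp))
    obtain ⟨i, hi⟩ := hat.nonempty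
    have hti : t = {i} := by
      refine ((hat.eq_empty_or_eq {i} (by simpa using hi) (hmem _ ?_) (hmem _ ?_)).resolve_left
        (by simp)).symm
      · rw [Finset.mem_singleton]
        rintro rfl
        exact hT (ht hi)
      · exact fun hn => hT (ht (Finset.sdiff_subset hn))
    rw [Multiset.card_cons, ih (fun s hs => hm s (by simp [hs])) (T \ t)
      (fun hn => hT (Finset.sdiff_subset hn)) hr, Finset.card_sdiff_of_subset ht, hti,
      Finset.card_singleton]
    have := Finset.card_pos.2 ⟨i, ht hi⟩
    omega

/-- In a factorization into irreducibles of a product with factor `g none`, the irreducible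
containing `g none` belongs to an atomic set `J`, and each of the others is a single `g (some v)`. -/
theorem exists_isAtomicSet_of_isSignedProd (hirr : ∀ i, Irreducible (g i))
    (hone : ∀ i, (g i).eval 1 = 1) (hmem : ∀ T, none ∉ T → ∏ i ∈ T, g i ∈ integerValued)
    (m : Multiset integerValued) (hm : ∀ s ∈ m, Irreducible s) (T : Finset (Option V))
    (hT : none ∈ T) (h : IsSignedProd g T m.prod) :
    ∃ J ⊆ T, none ∈ J ∧ IsAtomicSet g J ∧ m.card = (T \ J).card + 1 := by
  induction m using Multiset.induction generalizing T with
  | empty =>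
    rw [(h.isUnit_iff hirr).1 (by simp)] at hT
    simp at hT
  | cons s m ih =>
    rw [Multiset.prod_cons] at h
    obtain ⟨t, ht, hs, hr⟩ := h.exists_of_mul hirr hone
    have hat := (hs.irreducible_iff hirr hone).1 (hm s (by simp))
    by_cases hnt : none ∈ t
    · refine ⟨t, ht, hnt, hat, ?_⟩
      rw [Multiset.card_cons, card_eq_of_isSignedProd hirr hone hmem m
        (fun s hs => hm s (by simp [hs])) (T \ t) (by simp [hnt]) hr]
    · obtain ⟨J, hJ, hnJ, hJat, hcard⟩ :=
        ih (fun s hs => hm s (by simp [hs])) (T \ t) (by simp [hT, hnt]) hr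
      have htcard : t.card = 1 := by
        have := card_eq_of_isSignedProd hirr hone hmem {s} (by simpa using hm s (by simp)) t hnt
          (by simpa using hs)
        simpa using this.symm
      have hJT := hJ.trans Finset.sdiff_subset
      refine ⟨J, hJT, hnJ, hJat, ?_⟩
      rw [Multiset.card_cons, hcard, Finset.card_sdiff_of_subset hJ, Finset.card_sdiff_of_subset ht,
        Finset.card_sdiff_of_subset hJT, htcard]
      have := Finset.card_le_card hJ
      have h2 := Finset.card_pos.2 ⟨none, hnJ⟩
      rw [Finset.card_sdiff_of_subset ht, htcard] at this
      omega

variable [Fintype V] [DecidableEq κ] {c : V → κ}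

/-- The vertices of `V` outside the part `k` of the complete multipartite graph with parts the
fibres of `c`, together with `none`. -/
def complPart (c : V → κ) (k : κ) : Finset (Option V) :=
  insert none (({v | c v ≠ k} : Finset V).map Function.Embedding.some)

@[simp] theorem none_mem_complPart (k : κ) : none ∈ complPart c k := by simp [complPart]

@[simp] theorem some_mem_complPart {k : κ} {v : V} : some v ∈ complPart c k ↔ c v ≠ k := by
  simp [complPart]

/-- Minimal vertex covers of a complete multipartite graph are the complements of its parts. -/
theorem isAtomicSet_iff_exists_eq_complPart [Nonempty κ] (hc : Function.Surjective c)
    (hmem : ∀ T, ∏ i ∈ T, g i ∈ integerValued ↔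
      (none ∈ T → ∀ u v, c u ≠ c v → some u ∈ T ∨ some v ∈ T))
    {J : Finset (Option V)} (hJ : none ∈ J) :
    IsAtomicSet g J ↔ ∃ k, J = complPart c k := by
  constructor
  · intro hat
    have hcov := (hmem J).1 hat.mem hJ
    obtain ⟨k, hk⟩ : ∃ k, ∀ v, some v ∉ J → c v = k := by
      by_cases h : ∃ u, some u ∉ J
      · obtain ⟨u, hu⟩ := h
        refine ⟨c u, fun v hv => ?_⟩
        by_contra hne
        exact (hcov v u hne).elim hv hu
      · push Not at h
        exact ⟨Classical.arbitrary κ, fun v hv => absurd (h v) hv⟩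
    refine ⟨k, Finset.ext fun i => ?_⟩
    cases i with
    | none => simp [hJ]
    | some v =>
      rw [some_mem_complPart]
      refine ⟨fun hv hvk => ?_, fun hv => by_contra fun h => hv (hk v h)⟩
      -- A vertex of `J` in the part `k` could be split off.
      have h1 := hat.eq_empty_or_eq {some v} (by simpa using hv) ((hmem _).2 (by simp))
        ((hmem _).2 fun _ u w huw => by
          by_contra! hcon
          have hout : ∀ x, some x ∉ J \ {some v} → c x = k := fun x hx => by
            by_cases hxv : x = v
            · rw [hxv, hvk]
            · exact hk x fun hxJ => hx (by simp [hxJ, hxv])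
          exact huw ((hout u hcon.1).trans (hout w hcon.2).symm))
      rcases h1 with h1 | h1
      · simp at h1
      · simp [← h1] at hJ
  · rintro ⟨k, rfl⟩
    -- A part of the splitting that contains `none` omits a vertex of the part `k`, and hence no
    -- vertex of the other parts.
    have key : ∀ t ⊆ complPart c k, none ∈ t → ∏ i ∈ t, g i ∈ integerValued →
        t = complPart c k := fun t ht hnt htmem => by
      refine ht.antisymm fun i hi => ?_
      cases i with
      | none => exact hnt
      | some v =>
        obtain ⟨u, rfl⟩ := hc k
        refine ((hmem t).1 htmem hnt v u (some_mem_complPart.1 hi)).resolve_right fun hu => ?_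
        exact some_mem_complPart.1 (ht hu) rfl
    refine ⟨⟨none, hJ⟩, (hmem _).2 fun _ u v huv => ?_, fun t ht h1 h2 => ?_⟩
    · simp only [some_mem_complPart]
      by_contra! hcon
      exact huv (hcon.1.trans hcon.2.symm)
    · by_cases hnt : none ∈ t
      · exact Or.inr (key t ht hnt h1)
      · have := key _ Finset.sdiff_subset (by simp [hnt]) h2
        exact Or.inl (Finset.disjoint_self_iff_empty _ |>.1
          ((Finset.sdiff_eq_self_iff_disjoint.1 this).mono_left ht))

theorem univ_sdiff_complPart (k : κ) : Finset.univ \ complPart c k =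
    ({v | c v = k} : Finset V).map Function.Embedding.some := by
  ext (_ | v) <;> simp

/-- A finite family of parts, indexed by `κ`, is turned into an element of `Int(ℤ)` whose
factorizations into irreducibles have lengths one more than the sizes of the parts. -/
theorem exists_setOfLengths_eq_range_card [Nonempty κ] (hc : Function.Surjective c) :
    ∃ f : integerValued,
      setOfLengths f = Set.range fun k => Fintype.card {v // c v = k} + 1 := by
  obtain ⟨g, hirr, hone, hmem'⟩ := exists_irreducible_prod_mem_integerValued_iff
    (fun e : {e : V × V // c e.1 ≠ c e.2} => ({e.1.1, e.1.2} : Finset V))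
  have hmem : ∀ T, ∏ i ∈ T, g i ∈ integerValued ↔
      (none ∈ T → ∀ u v, c u ≠ c v → some u ∈ T ∨ some v ∈ T) := fun T => by
    rw [hmem']
    simp
  have hmem₀ : ∀ T, none ∉ T → ∏ i ∈ T, g i ∈ integerValued :=
    fun T hT => (hmem T).2 fun h => absurd h hT
  have huniv : ∏ i, g i ∈ integerValued := (hmem _).2 (by simp)
  refine ⟨⟨_, huniv⟩, Set.ext fun n => ?_⟩
  rw [mem_setOfLengths_iff_multiset, Set.mem_range]
  constructor
  · rintro ⟨-, m, hm, rfl, hprod⟩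
    obtain ⟨J, -, hJ, hat, hcard⟩ := exists_isAtomicSet_of_isSignedProd hirr hone hmem₀ m hm
      Finset.univ (Finset.mem_univ _) (hprod ▸ isSignedProd_mk huniv)
    obtain ⟨k, rfl⟩ := (isAtomicSet_iff_exists_eq_complPart hc hmem hJ).1 hat
    exact ⟨k, by rw [hcard, univ_sdiff_complPart, Finset.card_map, Fintype.card_subtype]⟩
  · rintro ⟨k, rfl⟩
    have hat := (isAtomicSet_iff_exists_eq_complPart hc hmem (none_mem_complPart k)).2 ⟨k, rfl⟩
    have hsingle : ∀ v : V, g (some v) ∈ integerValued := fun v => by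
      simpa using hmem₀ {some v} (by simp)
    have hsingle_irr : ∀ v : V, Irreducible (⟨_, hsingle v⟩ : integerValued) := fun v =>
      (IsSignedProd.irreducible_iff (T := {some v}) hirr hone ⟨1, by simp⟩).2
        ⟨by simp, by simpa using hsingle v, fun t ht _ _ => Finset.subset_singleton_iff.1 ht⟩
    refine ⟨Nat.succ_pos _, ⟨_, hat.mem⟩ ::ₘ
      (({v | c v = k} : Finset V).val.map fun v => ⟨_, hsingle v⟩), ?_, ?_, ?_⟩
    · intro s hs
      rcases Multiset.mem_cons.1 hs with rfl | hs
      · exact ((isSignedProd_mk hat.mem).irreducible_iff hirr hone).2 hat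
      · obtain ⟨v, -, rfl⟩ := Multiset.mem_map.1 hs
        exact hsingle_irr v
    · rw [Multiset.card_cons, Multiset.card_map, Finset.card_val, Fintype.card_subtype]
    · refine Subtype.ext ?_
      change _ = ∏ i, g i
      rw [← Finset.prod_sdiff (Finset.subset_univ (complPart c k)), univ_sdiff_complPart,
        Finset.prod_map, mul_comm, Multiset.prod_cons, Subring.coe_mul]
      congr 1
      exact SubmonoidClass.coe_finsetProd (fun v => (⟨_, hsingle v⟩ : integerValued)) _

end Multipartite

theorem mainTheorem2 (S : Finset ℕ) (hS : ∀ n ∈ S, 2 ≤ n) :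
    ∃ f : integerValued, setOfLengths f = (S : Set ℕ) := by
  rcases S.eq_empty_or_nonempty with rfl | ⟨n₀, hn₀⟩
  · -- A unit is not a product of a positive number of irreducibles.
    refine ⟨1, Set.eq_empty_of_forall_notMem ?_ |>.trans Finset.coe_empty.symm⟩
    rintro n ⟨hn, s, hs, h1⟩
    exact (hs ⟨0, hn⟩).not_isUnit
      (isUnit_of_dvd_one (h1 ▸ Finset.dvd_prod_of_mem s (Finset.mem_univ _)))
  · have : Nonempty S := ⟨⟨n₀, hn₀⟩⟩
    obtain ⟨f, hf⟩ := exists_setOfLengths_eq_range_card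
      (c := (Sigma.fst : (Σ n : S, Fin (n - 1)) → S))
      fun n => ⟨⟨n, 0, by have := hS n n.2; omega⟩, rfl⟩
    refine ⟨f, hf.trans (Set.ext fun n => ?_)⟩
    have hcard : ∀ k : S,
        Fintype.card {v : Σ n : S, Fin (n - 1) // v.1 = k} + 1 = k := fun k => by
      rw [Fintype.card_congr (Equiv.sigmaSubtype k), Fintype.card_fin]
      have := hS k k.2
      omega
    simp [hcard]
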